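/- Let $L$ be a countable relational language. Structures are nonempty, and "countable" means finite or countably infinite. Fix a list of all finitary quantifier-free $L$-formulas in the variables $x_0,x_1,\dots$. *Formulas.* In the infinitary logic $L_{\omega_1\omega}$, the $\Sigma_0$ and the $\Pi_0$ formulas are the finitary quantifier-free formulas. For a countable ordinal $\alpha>0$, a $\Sigma_\alpha$ formula is one of the form $\bigvee_{i\in\mathbb N}\exists\bar x_i\,\psi_i$ with each $\psi_i$ in $\Pi_\beta$ for some $\beta<\alpha$, and a $\Pi_\alpha$ formula is one of the form $\bigwedge_{i\in\mathbb N}\forall\bar x_i\,\psi_i$ with each $\psi_i$ in $\Sigma_\beta$ for some $\beta<\alpha$ (the $\bar x_i$ are finite, possibly empty, tuples). A *Scott sentence* of a countable structure $\mathcal M$ is a sentence $\varphi$ of $L_{\omega_1\omega}$ such that, for every countable $L$-structure $\mathcal N$, $\mathcal N\models\varphi$ if and only if $\mathcal N\cong\mathcal M$. *Back-and-forth relations.* For $L$-structures $\mathcal M,\mathcal N$ with tuples $\bar a\in\mathcal M$, $\bar b\in\mathcal N$ of the same finite length $n$, define $(\mathcal M,\bar a)\le_\alpha(\mathcal N,\bar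 b)$ by recursion on the countable ordinal $\alpha$: $(\mathcal M,\bar a)\le_0(\mathcal N,\bar b)$ if $\bar a$ and $\bar b$ satisfy the same formulas among those of the first $n$ formulas of the list whose variables are among $x_0,\dots,x_{n-1}$; and for $\alpha>0$, $(\mathcal M,\bar a)\le_\alpha(\mathcal N,\bar b)$ if for every $\beta<\alpha$ and every finite tuple $\bar d\in\mathcal N$ there is a tuple $\bar c\in\mathcal M$ of the same length with $(\mathcal N,\bar b\bar d)\le_\beta(\mathcal M,\bar a\bar c)$. Write $\mathcal M\le_\alpha\mathcal N$ when $\bar a$ and $\bar b$ are empty. **Corollary.** Let $\mathcal M$ be a countable $L$-structure and let $\alpha<\omega_1$. 1. If, for all countable $L$-structures $\mathcal N$, $\mathcal M\le_\alpha\mathcal N$ implies $\mathcal M\cong\mathcal N$, then $\mathcal M$ has a $\Pi_{\alpha+2}$ Scott sentence. 2. If, for all countable $L$-structures $\mathcal N$, $\mathcal N\le_\alpha\mathcal M$ implies $\mathcal M\cong\mathcal N$, then $\mathcal M$ has a $\Pi_{\alpha+1}$ Scott sentence. -/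

import Mathlib

open scoped FirstOrder
open scoped Ordinal

universe u v w

namespace ScottAnalysis

/-- Formulas of the infinitary logic `L_{ω₁ω}` with free variables `x_0, …, x_{n-1}`.
Conjunctions and disjunctions are over countable families, indexed by `ℕ` (a finite nonempty family
is listed with repetitions, an empty conjunction or disjunction is `⊤` or `⊥`). The quantifiers bind
a finite block of `k` new variables `x_n, …, x_{n+k-1}`, where `k = 0` is allowed. -/
inductive InfFormula (L : FirstOrder.Language.{u, v}) : ℕ → Type (max u v)
  /-- a finitary first-order formula -/
  | finitary {n : ℕ} (φ : L.Formula (Fin n)) : InfFormula L n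
  /-- negation -/
  | neg {n : ℕ} (φ : InfFormula L n) : InfFormula L n
  /-- countable conjunction -/
  | conj {n : ℕ} (φ : ℕ → InfFormula L n) : InfFormula L n
  /-- countable disjunction -/
  | disj {n : ℕ} (φ : ℕ → InfFormula L n) : InfFormula L n
  /-- universal quantification over a tuple -/
  | all {n : ℕ} (k : ℕ) (φ : InfFormula L (n + k)) : InfFormula L n
  /-- existential quantification over a tuple -/
  | ex {n : ℕ} (k : ℕ) (φ : InfFormula L (n + k)) : InfFormula L n

/-- Satisfaction: `φ.Realize a` says that `M ⊨ φ(a)`. -/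
def InfFormula.Realize {L : FirstOrder.Language.{u, v}} {M : Type w} [L.Structure M] :
    {n : ℕ} → InfFormula L n → (Fin n → M) → Prop
  | _, .finitary φ, a => FirstOrder.Language.Formula.Realize φ a
  | _, .neg φ, a => ¬ φ.Realize a
  | _, .conj φ, a => ∀ i, (φ i).Realize a
  | _, .disj φ, a => ∃ i, (φ i).Realize a
  | _, .all k φ, a => ∀ c : Fin k → M, φ.Realize (Fin.append a c)
  | _, .ex k φ, a => ∃ c : Fin k → M, φ.Realize (Fin.append a c)

mutual

/-- `Σ_α` formulas: `Σ_0` is finitary quantifier-free, and for `α > 0` a `Σ_α` formula is a countable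
disjunction of formulas `∃ x̄_i ψ_i` with `ψ_i` in `Π_β` for some `β < α`. -/
inductive IsSigma {L : FirstOrder.Language.{u, v}} : Ordinal.{0} → {n : ℕ} → InfFormula L n → Prop
  | qf {n : ℕ} (φ : L.Formula (Fin n)) (hφ : φ.IsQF) : IsSigma 0 (.finitary φ)
  | disj_ex {n : ℕ} {α : Ordinal.{0}} (k : ℕ → ℕ) (ψ : (i : ℕ) → InfFormula L (n + k i))
      (β : ℕ → Ordinal.{0}) (hβ : ∀ i, β i < α) (hψ : ∀ i, IsPi (β i) (ψ i)) :
      IsSigma α (.disj fun i => .ex (k i) (ψ i))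

/-- `Π_α` formulas: `Π_0` is finitary quantifier-free, and for `α > 0` a `Π_α` formula is a countable
conjunction of formulas `∀ x̄_i ψ_i` with `ψ_i` in `Σ_β` for some `β < α`. -/
inductive IsPi {L : FirstOrder.Language.{u, v}} : Ordinal.{0} → {n : ℕ} → InfFormula L n → Prop
  | qf {n : ℕ} (φ : L.Formula (Fin n)) (hφ : φ.IsQF) : IsPi 0 (.finitary φ)
  | conj_all {n : ℕ} {α : Ordinal.{0}} (k : ℕ → ℕ) (ψ : (i : ℕ) → InfFormula L (n + k i))
      (β : ℕ → Ordinal.{0}) (hβ : ∀ i, β i < α) (hψ : ∀ i, IsSigma (β i) (ψ i)) :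
      IsPi α (.conj fun i => .all (k i) (ψ i))

end

/-- `φ` is a Scott sentence of `M`: among countable structures, it characterizes `M` up to
isomorphism. Here and below countable structures may be finite, and structures are nonempty. -/
def IsScottSentence {L : FirstOrder.Language.{u, v}} (M : Type w) [L.Structure M] (φ : InfFormula L 0) : Prop :=
  ∀ (N : Type w) [L.Structure N] [Countable N] [Nonempty N],
    φ.Realize (Fin.elim0 : Fin 0 → N) ↔ Nonempty (M ≃[L] N)

/-- `e` enumerates (possibly with repetitions) the finitary quantifier-free `L`-formulas in the
variables `x_0, x_1, …`. -/
def IsQFEnumeration {L : FirstOrder.Language.{u, v}} (e : ℕ → L.Formula ℕ) : Prop :=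
  Set.range e = {φ : L.Formula ℕ | φ.IsQF}

/-- The tuples `a` and `b` of length `n` satisfy the same formulas among the first `n` formulas of the
list `e` (those of them that are about `x_0, …, x_{n-1}`). Truth is evaluated under assignments `s`
and `t` that extend `a` and `b`; their other values are irrelevant. -/
def AgreeOnFirst {L : FirstOrder.Language.{u, v}} (e : ℕ → L.Formula ℕ) (M N : Type w)
    [L.Structure M] [L.Structure N] (n : ℕ) (a : Fin n → M) (b : Fin n → N) : Prop :=
  ∀ i < n, (∀ j ∈ (e i).freeVarFinset, j < n) →
    ∀ (s : ℕ → M) (t : ℕ → N), (∀ j : Fin n, s j = a j) → (∀ j : Fin n, t j = b j) →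
      ((e i).Realize s ↔ (e i).Realize t)

/-- The standard asymmetric back-and-forth relation `(M, a) ≤_α (N, b)` between structures with
tuples of length `n`. For `α = 0` only the first clause has content, for `α > 0` only the second. -/
def BackForth {L : FirstOrder.Language.{u, v}} (e : ℕ → L.Formula ℕ) (α : Ordinal.{0}) (M N : Type w)
    [L.Structure M] [L.Structure N] (n : ℕ) (a : Fin n → M) (b : Fin n → N) : Prop :=
  (α = 0 → AgreeOnFirst e M N n a b) ∧
    ∀ β, β < α → ∀ (k : ℕ) (d : Fin k → N), ∃ c : Fin k → M,
      BackForth e β N M (n + k) (Fin.append b d) (Fin.append a c)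
termination_by α

/-- `M ≤_α N`: the back-and-forth relation between the structures with empty tuples. -/
def BFLe {L : FirstOrder.Language.{u, v}} (e : ℕ → L.Formula ℕ) (α : Ordinal.{0}) (M N : Type w)
    [L.Structure M] [L.Structure N] : Prop :=
  BackForth e α M N 0 Fin.elim0 Fin.elim0

theorem backForth_zero {L : FirstOrder.Language.{u, v}} (e : ℕ → L.Formula ℕ) (M N : Type w)
    [L.Structure M] [L.Structure N] (n : ℕ) (a : Fin n → M) (b : Fin n → N) :
    BackForth e 0 M N n a b ↔ AgreeOnFirst e M N n a b := by
  rw [BackForth]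
  simp

theorem backForth_of_pos {L : FirstOrder.Language.{u, v}} (e : ℕ → L.Formula ℕ) {α : Ordinal.{0}} (hα : 0 < α)
    (M N : Type w) [L.Structure M] [L.Structure N] (n : ℕ) (a : Fin n → M) (b : Fin n → N) :
    BackForth e α M N n a b ↔ ∀ β, β < α → ∀ (k : ℕ) (d : Fin k → N), ∃ c : Fin k → M,
      BackForth e β N M (n + k) (Fin.append b d) (Fin.append a c) := by
  rw [BackForth]
  simp [hα.ne']

end ScottAnalysis

/-!
The proof writes down the two Scott sentences. Fix `M`. By recursion on `α`, one defines for each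
tuple `d` of `M` a `Π_α` condition `Above α d` on tuples `x` of an arbitrary structure `N`, and from it
a `Π_{α+1}` condition `Below α d`; these imitate `(M, d) ≤_α (N, x)` and `(N, x) ≤_α (M, d)`. A direct
transcription of the back-and-forth definition would gain several quantifiers at each step. Instead,
`Above α d x` only says that no extension of `x` satisfies `Above γ c`, `γ < α`, for a tuple `c` of `M`
that is `≤_γ` no extension of `d`. In `M` both conditions are exact (`above_self_iff`,
`below_self_iff`), because `≤_γ` is reflexive and transitive.

In other structures soundness needs the sentences `Covered γ`: each tuple either satisfies `Below γ`
for some extension of `d`, or satisfies `Above γ c` for one of the tuples `c` just mentioned. They are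
true in `M` and of complexity only `Π_{γ+3}`, as they are not iterated. If `N` satisfies `Covered γ`
for all `γ < α`, then `Above α` implies the back-and-forth relation (`backForth_of_above`); for
`Below α` the ranks with `γ + 1 < α` suffice (`backForth_of_below`).

Hence `Above α ∅` together with `Covered γ` for `γ < α` is a `Π_{α+2}` sentence true in `M` and implying
`M ≤_α N`, and `Below α ∅` together with `Covered γ` for `γ + 1 < α` is a `Π_{α+1}` sentence true in `M`
and implying `N ≤_α M`. Under the respective hypothesis on `M` these are Scott sentences.
-/

namespace ScottAnalysis

open FirstOrder FirstOrder.Language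

/-! ### Predicates definable by formulas of a given complexity -/

/-- A predicate on `L`-structures with a distinguished `n`-tuple: the meaning of a formula in `n`
free variables. -/
abbrev PointedPred (L : FirstOrder.Language.{u, v}) (n : ℕ) :=
  ∀ (N : Type w) [L.Structure N], (Fin n → N) → Prop

/-- `P` is defined, uniformly in all nonempty structures, by a `Σ_α` formula. -/
def SigmaDef {L : FirstOrder.Language.{u, v}} (α : Ordinal.{0}) {n : ℕ}
    (P : PointedPred.{u, v, w} L n) : Prop :=
  ∃ φ : InfFormula L n, IsSigma α φ ∧
    ∀ (N : Type w) [L.Structure N] [Nonempty N] (a : Fin n → N), φ.Realize a ↔ P N a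

/-- `P` is defined, uniformly in all nonempty structures, by a `Π_α` formula. -/
def PiDef {L : FirstOrder.Language.{u, v}} (α : Ordinal.{0}) {n : ℕ}
    (P : PointedPred.{u, v, w} L n) : Prop :=
  ∃ φ : InfFormula L n, IsPi α φ ∧
    ∀ (N : Type w) [L.Structure N] [Nonempty N] (a : Fin n → N), φ.Realize a ↔ P N a

section Definability

variable {L : FirstOrder.Language.{u, v}} {α β : Ordinal.{0}} {n : ℕ}

theorem PiDef.congr {P Q : PointedPred.{u, v, w} L n} (hP : PiDef α P)
    (h : ∀ (N : Type w) [L.Structure N] [Nonempty N] (a : Fin n → N), P N a ↔ Q N a) :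
    PiDef α Q := by
  obtain ⟨φ, hφ, hr⟩ := hP
  exact ⟨φ, hφ, fun N _ _ a => (hr N a).trans (h N a)⟩

theorem SigmaDef.congr {P Q : PointedPred.{u, v, w} L n} (hP : SigmaDef α P)
    (h : ∀ (N : Type w) [L.Structure N] [Nonempty N] (a : Fin n → N), P N a ↔ Q N a) :
    SigmaDef α Q := by
  obtain ⟨φ, hφ, hr⟩ := hP
  exact ⟨φ, hφ, fun N _ _ a => (hr N a).trans (h N a)⟩

/-- Transport along an equality of arities. -/
theorem SigmaDef.cast {m : ℕ} (h : n = m) {P : PointedPred.{u, v, w} L n} (hP : SigmaDef α P) :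
    SigmaDef (L := L) α (fun N _ (a : Fin m → N) => P N (a ∘ Fin.cast h)) := by
  subst h
  exact hP

theorem append_fin_zero {X : Type*} (a : Fin n → X) (c : Fin 0 → X) : Fin.append a c = a := by
  rw [Subsingleton.elim c Fin.elim0, Fin.append_elim0]
  rfl

/-- `Π_α` predicates are closed under countable conjunctions of universally quantified predicates
of lower `Σ` complexity. The hypothesis `0 < α` is needed for the empty conjunction. -/
theorem PiDef.forall_block (hα : 0 < α) {ι : Type*} [Countable ι] (k : ι → ℕ)
    (P : ∀ i, PointedPred.{u, v, w} L (n + k i)) (β : ι → Ordinal.{0}) (hβ : ∀ i, β i < α)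
    (hP : ∀ i, SigmaDef (β i) (P i)) :
    PiDef (L := L) α (fun N _ (a : Fin n → N) => ∀ i, ∀ c : Fin (k i) → N, P i N (Fin.append a c)) := by
  rcases isEmpty_or_nonempty ι with hι | hι
  · refine ⟨_, .conj_all (fun _ => 0) (fun _ => .finitary ⊤) (fun _ => 0) (fun _ => hα)
      (fun _ => .qf _ BoundedFormula.IsQF.top), fun N _ _ a => ?_⟩
    simp [InfFormula.Realize]
  · obtain ⟨f, hf⟩ := exists_surjective_nat ι
    choose φ hφ hr using hP
    refine ⟨_, .conj_all (fun j => k (f j)) (fun j => φ (f j)) (fun j => β (f j))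
      (fun j => hβ _) (fun j => hφ _), fun N _ _ a => ?_⟩
    simp only [InfFormula.Realize, hr]
    exact (hf.forall (p := fun i => ∀ c : Fin (k i) → N, P i N (Fin.append a c))).symm

/-- `Σ_α` predicates are closed under countable disjunctions of existentially quantified predicates
of lower `Π` complexity. -/
theorem SigmaDef.exists_block (hα : 0 < α) {ι : Type*} [Countable ι] (k : ι → ℕ)
    (P : ∀ i, PointedPred.{u, v, w} L (n + k i)) (β : ι → Ordinal.{0}) (hβ : ∀ i, β i < α)
    (hP : ∀ i, PiDef (β i) (P i)) :
    SigmaDef (L := L) α (fun N _ (a : Fin n → N) => ∃ i, ∃ c : Fin (k i) → N, P i N (Fin.append a c)) := by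
  rcases isEmpty_or_nonempty ι with hι | hι
  · refine ⟨_, .disj_ex (fun _ => 0) (fun _ => .finitary ⊥) (fun _ => 0) (fun _ => hα)
      (fun _ => .qf _ BoundedFormula.isQF_bot), fun N _ _ a => ?_⟩
    simp [InfFormula.Realize]
  · obtain ⟨f, hf⟩ := exists_surjective_nat ι
    choose φ hφ hr using hP
    refine ⟨_, .disj_ex (fun j => k (f j)) (fun j => φ (f j)) (fun j => β (f j))
      (fun j => hβ _) (fun j => hφ _), fun N _ _ a => ?_⟩
    simp only [InfFormula.Realize, hr]
    exact (hf.exists (p := fun i => ∃ c : Fin (k i) → N, P i N (Fin.append a c))).symm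

theorem PiDef.forall_sigma (hα : 0 < α) {ι : Type*} [Countable ι]
    (P : ι → PointedPred.{u, v, w} L n) (β : ι → Ordinal.{0}) (hβ : ∀ i, β i < α)
    (hP : ∀ i, SigmaDef (β i) (P i)) :
    PiDef (L := L) α (fun N _ (a : Fin n → N) => ∀ i, P i N a) := by
  refine (PiDef.forall_block hα (fun _ => 0) P β hβ hP).congr fun N _ _ a => ?_
  simp only [append_fin_zero]
  exact forall_congr' fun i => ⟨fun h => h Fin.elim0, fun h _ => h⟩

theorem SigmaDef.exists_pi (hα : 0 < α) {ι : Type*} [Countable ι]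
    (P : ι → PointedPred.{u, v, w} L n) (β : ι → Ordinal.{0}) (hβ : ∀ i, β i < α)
    (hP : ∀ i, PiDef (β i) (P i)) :
    SigmaDef (L := L) α (fun N _ (a : Fin n → N) => ∃ i, P i N a) := by
  refine (SigmaDef.exists_block hα (fun _ => 0) P β hβ hP).congr fun N _ _ a => ?_
  simp only [append_fin_zero]
  exact exists_congr fun i => ⟨fun ⟨_, h⟩ => h, fun h => ⟨Fin.elim0, h⟩⟩

theorem PiDef.of_sigma_lt {P : PointedPred.{u, v, w} L n} (hP : SigmaDef β P) (h : β < α) :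
    PiDef α P :=
  (PiDef.forall_sigma (pos_of_gt h) (fun _ : Unit => P) (fun _ => β) (fun _ => h)
    (fun _ => hP)).congr fun N _ _ a => by simp

theorem PiDef.mono {P : PointedPred.{u, v, w} L n} (hP : PiDef β P) (h : β ≤ α) : PiDef α P := by
  rcases h.eq_or_lt with rfl | h
  · exact hP
  obtain ⟨φ, hφ, hr⟩ := hP
  cases hφ with
  | qf φ hφ => exact PiDef.of_sigma_lt ⟨_, .qf φ hφ, hr⟩ h
  | conj_all k ψ γ hγ hψ => exact ⟨_, .conj_all k ψ γ (fun i => (hγ i).trans h) hψ, hr⟩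

/-- The negation of a `Π_α` predicate is `Σ_α`, by pushing the negation inwards. -/
theorem PiDef.not : ∀ (α : Ordinal.{0}) {n : ℕ} {P : PointedPred.{u, v, w} L n}, PiDef α P →
    SigmaDef (L := L) α (fun N _ (a : Fin n → N) => ¬ P N a) := by
  have key : ∀ (α : Ordinal.{0}), (∀ {n : ℕ} (φ : InfFormula L n), IsPi α φ →
      SigmaDef.{u, v, w} (L := L) α (fun N _ (a : Fin n → N) => ¬ φ.Realize a)) ∧
      (∀ {n : ℕ} (φ : InfFormula L n), IsSigma α φ →
      PiDef.{u, v, w} (L := L) α (fun N _ (a : Fin n → N) => ¬ φ.Realize a)) := by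
    intro α
    induction α using WellFoundedLT.induction with
    | ind α ih =>
      constructor
      · intro n φ hφ
        cases hφ with
        | qf φ hφ => exact ⟨_, .qf _ hφ.not, fun N _ _ a => by
            simp only [InfFormula.Realize]; exact Iff.rfl⟩
        | conj_all k ψ γ hγ hψ =>
          refine (SigmaDef.exists_block (pos_of_gt (hγ 0)) k _ γ hγ
            (fun i => (ih _ (hγ i)).2 (ψ i) (hψ i))).congr fun N _ _ a => ?_
          simp [InfFormula.Realize]
      · intro n φ hφ
        cases hφ with
        | qf φ hφ => exact ⟨_, .qf _ hφ.not, fun N _ _ a => by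
            simp only [InfFormula.Realize]; exact Iff.rfl⟩
        | disj_ex k ψ γ hγ hψ =>
          refine (PiDef.forall_block (pos_of_gt (hγ 0)) k _ γ hγ
            (fun i => (ih _ (hγ i)).1 (ψ i) (hψ i))).congr fun N _ _ a => ?_
          simp [InfFormula.Realize]
  rintro α n P ⟨φ, hφ, hr⟩
  exact ((key α).1 φ hφ).congr fun N _ _ a => not_congr (hr N a)

/-- For `α > 0`, the `Π_α` predicates are closed under countable conjunctions. -/
theorem PiDef.forall (hα : 0 < α) {ι : Type*} [Countable ι] (P : ι → PointedPred.{u, v, w} L n)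
    (hP : ∀ i, PiDef α (P i)) : PiDef (L := L) α (fun N _ (a : Fin n → N) => ∀ i, P i N a) := by
  choose φ hφ hr using hP
  have hshape : ∀ i, ∃ (k : ℕ → ℕ) (ψ : (j : ℕ) → InfFormula L (n + k j)) (β : ℕ → Ordinal.{0}),
      (∀ j, β j < α) ∧ (∀ j, IsSigma (β j) (ψ j)) ∧ φ i = .conj fun j => .all (k j) (ψ j) := by
    intro i
    have h := hφ i
    generalize φ i = θ at h
    cases h with
    | qf => exact absurd hα (lt_irrefl _)
    | conj_all k ψ β hβ hψ => exact ⟨k, ψ, β, hβ, hψ, rfl⟩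
  choose k ψ β hβ hψ heq using hshape
  refine (PiDef.forall_block hα (ι := ι × ℕ) (fun p => k p.1 p.2)
    (fun p N _ a => (ψ p.1 p.2).Realize a) (fun p => β p.1 p.2) (fun p => hβ _ _)
    (fun p => ⟨_, hψ _ _, fun _ _ _ _ => Iff.rfl⟩)).congr fun N _ _ a => ?_
  simp only [← hr, heq, InfFormula.Realize, Prod.forall]

theorem PiDef.and (hα : 0 < α) {P Q : PointedPred.{u, v, w} L n} (hP : PiDef α P)
    (hQ : PiDef α Q) : PiDef (L := L) α (fun N _ (a : Fin n → N) => P N a ∧ Q N a) :=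
  (PiDef.forall hα (fun b : Bool => if b then P else Q)
    (by rintro (_ | _) <;> simpa)).congr fun N _ _ a => by simp [and_comm]

/-- Universal closure of a `Σ_β` predicate. -/
theorem PiDef.forall_closure {P : PointedPred.{u, v, w} L n} (hP : SigmaDef β P) (h : β < α) :
    PiDef (L := L) (n := 0) α (fun N _ _ => ∀ z : Fin n → N, P N z) := by
  refine (PiDef.forall_block (n := 0) (pos_of_gt h) (fun _ : Unit => n)
    (fun _ N _ a => P N (a ∘ Fin.cast (Nat.zero_add n).symm)) (fun _ => β) (fun _ => h)
    (fun _ => hP.cast (Nat.zero_add n).symm)).congr fun N _ _ a => ?_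
  have hc : ∀ c : Fin n → N, Fin.append a c ∘ Fin.cast (Nat.zero_add n).symm = c := fun c => by
    rw [Subsingleton.elim a Fin.elim0, Fin.elim0_append]
    rfl
  simp [hc]

end Definability

/-! ### Invariance under isomorphism -/

theorem comp_append {X Y : Type*} (f : X → Y) {n k : ℕ} (a : Fin n → X) (c : Fin k → X) :
    f ∘ Fin.append a c = Fin.append (f ∘ a) (f ∘ c) := by
  funext i
  refine Fin.addCases (fun i => ?_) (fun i => ?_) i <;> simp

theorem InfFormula.realize_equiv {L : FirstOrder.Language.{u, v}} {M N : Type w} [L.Structure M]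
    [L.Structure N] (f : M ≃[L] N) {n : ℕ} (φ : InfFormula L n) (a : Fin n → M) :
    φ.Realize (f ∘ a) ↔ φ.Realize a := by
  have hf : ∀ k, Function.Surjective (fun c : Fin k → M => f ∘ c) := fun k =>
    f.surjective.comp_left
  induction φ with
  | finitary φ => exact StrongHomClass.realize_formula f φ
  | neg φ ih => exact not_congr (ih a)
  | conj φ ih => exact forall_congr' fun i => ih i a
  | disj φ ih => exact exists_congr fun i => ih i a
  | all k φ ih =>
    simp only [InfFormula.Realize, (hf k).forall, ← comp_append, ih]
  | ex k φ ih =>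
    simp only [InfFormula.Realize, (hf k).exists, ← comp_append, ih]

/-! ### Agreement and the back-and-forth preorder -/

section BackForth

variable {L : FirstOrder.Language.{u, v}} {e : ℕ → L.Formula ℕ}

theorem realize_congr_freeVar {N : Type w} [L.Structure N] (φ : L.Formula ℕ) {s t : ℕ → N}
    (h : ∀ j ∈ φ.freeVarFinset, s j = t j) : φ.Realize s ↔ φ.Realize t := by
  have h1 := BoundedFormula.realize_restrictFreeVar (φ := φ) (f := fun a => (a : ℕ)) (v := s)
    (xs := default) s (fun _ => rfl)
  have h2 := BoundedFormula.realize_restrictFreeVar (φ := φ) (f := fun a => (a : ℕ)) (v := s)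
    (xs := default) t (fun a => h a a.2)
  exact h1.symm.trans h2

theorem AgreeOnFirst.refl {M : Type w} [L.Structure M] {n : ℕ} (a : Fin n → M) :
    AgreeOnFirst e M M n a a := by
  intro i _ hv s t hs ht
  refine realize_congr_freeVar _ fun j hj => ?_
  rw [hs ⟨j, hv j hj⟩, ht ⟨j, hv j hj⟩]

theorem AgreeOnFirst.symm {M N : Type w} [L.Structure M] [L.Structure N] {n : ℕ} {a : Fin n → M}
    {b : Fin n → N} (h : AgreeOnFirst e M N n a b) : AgreeOnFirst e N M n b a :=
  fun i hi hv s t hs ht => (h i hi hv t s ht hs).symm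

theorem exists_extension {X : Type*} [Nonempty X] {n : ℕ} (a : Fin n → X) :
    ∃ s : ℕ → X, ∀ j : Fin n, s j = a j :=
  ⟨fun j => if h : j < n then a ⟨j, h⟩ else Classical.arbitrary X, fun j => by simp⟩

theorem AgreeOnFirst.trans {M N P : Type w} [L.Structure M] [L.Structure N] [L.Structure P]
    [Nonempty N] {n : ℕ} {a : Fin n → M} {b : Fin n → N} {c : Fin n → P}
    (h₁ : AgreeOnFirst e M N n a b) (h₂ : AgreeOnFirst e N P n b c) :
    AgreeOnFirst e M P n a c := by
  intro i hi hv s t hs ht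
  obtain ⟨r, hr⟩ := exists_extension b
  exact (h₁ i hi hv s r hs hr).trans (h₂ i hi hv r t hr ht)

theorem BackForth.refl {M : Type w} [L.Structure M] (α : Ordinal.{0}) {n : ℕ} (a : Fin n → M) :
    BackForth e α M M n a a := by
  induction α using WellFoundedLT.induction generalizing n with
  | ind α ih =>
    rw [BackForth]
    exact ⟨fun _ => .refl a, fun β hβ k d => ⟨d, ih β hβ _⟩⟩

theorem BackForth.trans {M N P : Type w} [L.Structure M] [L.Structure N] [L.Structure P]
    [Nonempty N] {α : Ordinal.{0}} {n : ℕ} {a : Fin n → M} {b : Fin n → N} {c : Fin n → P}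
    (h₁ : BackForth e α M N n a b) (h₂ : BackForth e α N P n b c) :
    BackForth e α M P n a c := by
  induction α using WellFoundedLT.induction generalizing n M P with
  | ind α ih =>
    rw [BackForth] at h₁ h₂ ⊢
    refine ⟨fun h => (h₁.1 h).trans (h₂.1 h), fun β hβ k d => ?_⟩
    obtain ⟨d', hd'⟩ := h₂.2 β hβ k d
    obtain ⟨d'', hd''⟩ := h₁.2 β hβ k d'
    exact ⟨d'', ih β hβ hd' hd''⟩

/-- Agreement with a fixed tuple is a finite conjunction of quantifier-free conditions. -/
theorem piDef_agreeOnFirst (he : ∀ i, (e i).IsQF) {M : Type w} [L.Structure M] [Nonempty M] {n : ℕ}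
    (d : Fin n → M) : PiDef (L := L) 0 (fun N _ (x : Fin n → N) => AgreeOnFirst e M N n d x) := by
  classical
  rcases n.eq_zero_or_pos with rfl | hn
  · refine ⟨_, .qf ⊤ BoundedFormula.IsQF.top, fun N _ _ x => ?_⟩
    simp [InfFormula.Realize, AgreeOnFirst]
  obtain ⟨s, hs⟩ := exists_extension d
  -- Variables outside the tuple do not occur in the formulas concerned, so they may be sent to `0`.
  let g : ℕ → Fin n := fun j => if h : j < n then ⟨j, h⟩ else ⟨0, hn⟩
  have hg : ∀ j : Fin n, g j = j := fun j => by simp [g]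
  have key : ∀ m, ∃ φ : L.Formula (Fin n), φ.IsQF ∧
      ∀ (N : Type w) [L.Structure N] (x : Fin n → N), φ.Realize x ↔
        ∀ i < m, (∀ j ∈ (e i).freeVarFinset, j < n) → ((e i).Realize s ↔ (e i).Realize (x ∘ g)) := by
    intro m
    induction m with
    | zero => exact ⟨⊤, BoundedFormula.IsQF.top, fun N _ x => by simp⟩
    | succ m ih =>
      obtain ⟨φ, hφ, hr⟩ := ih
      have hq : ((e m).relabel g : L.Formula (Fin n)).IsQF := (he m).relabel _
      by_cases hv : ∀ j ∈ (e m).freeVarFinset, j < n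
      · by_cases hm : (e m).Realize s
        · refine ⟨φ ⊓ (e m).relabel g, hφ.inf hq, fun N _ x => ?_⟩
          rw [Formula.realize_inf, hr, Formula.realize_relabel, Nat.forall_lt_succ_right]
          exact and_congr_right' ⟨fun h _ => iff_of_true hm h, fun h => (h hv).1 hm⟩
        · refine ⟨φ ⊓ ((e m).relabel g).not, hφ.inf hq.not, fun N _ x => ?_⟩
          rw [Formula.realize_inf, hr, Formula.realize_not, Formula.realize_relabel,
            Nat.forall_lt_succ_right]
          exact and_congr_right' ⟨fun h _ => iff_of_false hm h, fun h => mt (h hv).2 hm⟩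
      · refine ⟨φ, hφ, fun N _ x => ?_⟩
        rw [hr, Nat.forall_lt_succ_right]
        simp [hv]
  obtain ⟨φ, hφ, hr⟩ := key n
  refine ⟨_, .qf φ hφ, fun N _ _ x => ?_⟩
  simp only [InfFormula.Realize, hr]
  constructor
  · intro h i hi hv s' t hs' ht
    rw [realize_congr_freeVar (e i) (s := s') (t := s)
      (fun j hj => by rw [hs' ⟨j, hv j hj⟩, hs ⟨j, hv j hj⟩]), h i hi hv]
    refine realize_congr_freeVar _ fun j hj => ?_
    rw [ht ⟨j, hv j hj⟩, Function.comp_apply, hg ⟨j, hv j hj⟩]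
  · intro h i hi hv
    exact h i hi hv s (x ∘ g) hs fun j => by rw [Function.comp_apply, hg]

end BackForth

/-! ### Syntactic approximations of the back-and-forth relations -/

section Approximation

variable {L : FirstOrder.Language.{u, v}} (e : ℕ → L.Formula ℕ) (M : Type w) [L.Structure M]

/-- The tuple `c` of `M` is not `≤_γ` any extension of `d` by a tuple of `M`. -/
def NotBelowExtension (γ : Ordinal.{0}) {n k : ℕ} (d : Fin n → M) (c : Fin (n + k) → M) : Prop :=
  ∀ c' : Fin k → M, ¬ BackForth e γ M M (n + k) c (Fin.append d c')

/-- A `Π_α` approximation to `(M, d) ≤_α (N, x)`, exact when `N = M`: no extension of `x` lies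
above a tuple of `M` that is below no extension of `d`. -/
def Above (α : Ordinal.{0}) {n : ℕ} (d : Fin n → M) (N : Type w) [L.Structure N] (x : Fin n → N) :
    Prop :=
  (α = 0 → AgreeOnFirst e M N n d x) ∧
    ∀ γ, γ < α → ∀ (k : ℕ) (c : Fin (n + k) → M), NotBelowExtension e M γ d c →
      ∀ y : Fin k → N, ¬ Above γ c N (Fin.append x y)
termination_by α

/-- A `Π_{α+1}` approximation to `(N, x) ≤_α (M, c)`, exact when `N = M`. It is the definition of
that relation, with `Above` in place of the back-and-forth relations of lower rank. -/
def Below (α : Ordinal.{0}) {n : ℕ} (c : Fin n → M) (N : Type w) [L.Structure N] (x : Fin n → N) :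
    Prop :=
  (α = 0 → AgreeOnFirst e M N n c x) ∧
    ∀ δ, δ < α → ∀ (k : ℕ) (c' : Fin k → M), ∃ y : Fin k → N,
      Above e M δ (Fin.append c c') N (Fin.append x y)

/-- Every tuple of `N` (seen as one of length `n + k`) is either approximately below some extension
of `d`, or approximately above a tuple of `M` that is below no extension of `d`. This holds in `M`,
and in a general `N` it is what makes the approximations sound. -/
def Covered (γ : Ordinal.{0}) (N : Type w) [L.Structure N] : Prop :=
  ∀ (n k : ℕ) (d : Fin n → M) (z : Fin (n + k) → N),
    (∃ c : Fin k → M, Below e M γ (Fin.append d c) N z) ∨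
      ∃ c : Fin (n + k) → M, NotBelowExtension e M γ d c ∧ Above e M γ c N z

variable {e M}

/-- In `M` itself the approximation is exact: if `x` fails to lie above `d`, some extension of `x` is
itself a tuple below no extension of `d`; the other direction uses transitivity. -/
theorem above_self_iff [Nonempty M] (α : Ordinal.{0}) {n : ℕ} (d x : Fin n → M) :
    Above e M α d M x ↔ BackForth e α M M n d x := by
  induction α using WellFoundedLT.induction generalizing n with
  | ind α ih =>
    rw [Above, BackForth]
    refine and_congr Iff.rfl (forall₂_congr fun γ hγ => forall_congr' fun k => ?_)
    simp only [ih γ hγ, NotBelowExtension]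
    constructor
    · intro h y
      by_contra! hy
      exact h _ hy y (.refl γ _)
    · intro h c hc y hcy
      obtain ⟨c', hc'⟩ := h y
      exact hc c' (hcy.trans hc')

theorem below_self_iff [Nonempty M] (α : Ordinal.{0}) {n : ℕ} (c x : Fin n → M) :
    Below e M α c M x ↔ BackForth e α M M n x c := by
  rw [Below, BackForth]
  simp only [above_self_iff]
  exact and_congr ⟨fun h h0 => (h h0).symm, fun h h0 => (h h0).symm⟩ Iff.rfl

theorem covered_self [Nonempty M] (γ : Ordinal.{0}) : Covered e M γ M := by
  intro n k d z
  by_cases h : NotBelowExtension e M γ d z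
  · exact .inr ⟨z, h, (above_self_iff _ _ _).2 (.refl _ _)⟩
  · simp only [NotBelowExtension, not_forall, not_not] at h
    obtain ⟨c, hc⟩ := h
    exact .inl ⟨c, (below_self_iff _ _ _).2 hc⟩

/-- Soundness of `Below` at rank `α`, given soundness of `Above` at lower ranks. -/
theorem backForth_of_below_of_above {α : Ordinal.{0}} {N : Type w} [L.Structure N]
    (h : ∀ δ < α, ∀ {n : ℕ} {d : Fin n → M} {x : Fin n → N}, Above e M δ d N x →
      BackForth e δ M N n d x)
    {n : ℕ} {c : Fin n → M} {x : Fin n → N} (hc : Below e M α c N x) :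
    BackForth e α N M n x c := by
  rw [BackForth]
  refine ⟨fun h0 => (hc.1 h0).symm, fun δ hδ k c' => ?_⟩
  obtain ⟨y, hy⟩ := hc.2 δ hδ k c'
  exact ⟨y, h δ hδ hy⟩

/-- Soundness of `Above`: it excludes the second alternative in `Covered` for every extension of `x`,
so the first one supplies the answer in the back-and-forth game. -/
theorem backForth_of_above {α : Ordinal.{0}} {N : Type w} [L.Structure N]
    (hN : ∀ γ < α, Covered e M γ N) {n : ℕ} {d : Fin n → M} {x : Fin n → N}
    (h : Above e M α d N x) : BackForth e α M N n d x := by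
  induction α using WellFoundedLT.induction generalizing n with
  | ind α ih =>
    rw [Above] at h
    rw [BackForth]
    refine ⟨h.1, fun γ hγ k y => ?_⟩
    rcases hN γ hγ n k d (Fin.append x y) with ⟨c, hc⟩ | ⟨c, hc, hcz⟩
    · exact ⟨c, backForth_of_below_of_above (fun δ hδ _ _ _ => ih δ (hδ.trans hγ)
        fun ε hε => hN ε (hε.trans (hδ.trans hγ))) hc⟩
    · exact absurd hcz (h.2 γ hγ k c hc y)

/-- Soundness of `Below`. Only ranks `γ` with `γ + 1 < α` occur, since two moves of the game are
consumed before `Covered` is used; this saves the quantifiers that separate `Π_{α+1}` from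
`Π_{α+2}`. -/
theorem backForth_of_below {α : Ordinal.{0}} {N : Type w} [L.Structure N]
    (hN : ∀ γ, γ + 1 < α → Covered e M γ N) {n : ℕ} {c : Fin n → M} {x : Fin n → N}
    (h : Below e M α c N x) : BackForth e α N M n x c :=
  backForth_of_below_of_above (fun _ hδ _ _ _ => backForth_of_above fun γ hγ =>
    hN γ ((Order.add_one_le_of_lt hγ).trans_lt hδ)) h

/-! ### Scott sentences and the complexity of the approximations -/

/-- A definable property that `M` has and that forces a countable structure to be isomorphic to `M`
yields a Scott sentence; the converse direction is invariance of truth under isomorphism. -/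
theorem isScottSentence_of_piDef [Nonempty M] {α : Ordinal.{0}}
    {P : PointedPred.{u, v, w} L 0} (hP : PiDef α P)
    (hM : P M Fin.elim0)
    (h : ∀ (N : Type w) [L.Structure N] [Countable N] [Nonempty N], P N Fin.elim0 →
      Nonempty (M ≃[L] N)) :
    ∃ φ : InfFormula L 0, IsPi α φ ∧ IsScottSentence M φ := by
  obtain ⟨φ, hφ, hr⟩ := hP
  refine ⟨φ, hφ, fun N _ _ _ => ⟨fun hN => h N ((hr N _).1 hN), fun ⟨f⟩ => ?_⟩⟩
  rw [Subsingleton.elim (Fin.elim0 : Fin 0 → N) (f ∘ Fin.elim0), InfFormula.realize_equiv, hr]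
  exact hM

theorem countable_Iio_of_lt_omega_one {α : Ordinal.{0}} (hα : α < ω₁) : Countable (Set.Iio α) := by
  rw [← Cardinal.mk_le_aleph0_iff, Cardinal.mk_Iio_ordinal, ← Cardinal.lift_aleph0.{1, 0},
    Cardinal.lift_le, ← Order.lt_succ_iff, Cardinal.succ_aleph0, ← Cardinal.lt_ord,
    Cardinal.ord_aleph]
  exact hα

variable [Countable M] [Nonempty M]

theorem piDef_above (he : ∀ i, (e i).IsQF) {α : Ordinal.{0}} (hα : α < ω₁) {n : ℕ}
    (d : Fin n → M) : PiDef (L := L) α (fun N _ (x : Fin n → N) => Above e M α d N x) := by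
  induction α using WellFoundedLT.induction generalizing n with
  | ind α ih =>
    rcases eq_or_ne α 0 with rfl | h0
    · refine (piDef_agreeOnFirst he d).congr fun N _ _ x => ?_
      rw [Above]
      simp
    have := countable_Iio_of_lt_omega_one hα
    refine (PiDef.forall_block (pos_iff_ne_zero.2 h0)
      (ι := Σ (γ : Set.Iio α) (k : ℕ), {c : Fin (n + k) → M // NotBelowExtension e M γ.1 d c})
      (fun i => i.2.1) (fun i N _ z => ¬ Above e M i.1 i.2.2.1 N z) (fun i => i.1.1)
      (fun i => i.1.2) fun i => (ih _ i.1.2 (lt_trans i.1.2 hα) i.2.2.1).not).congr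
      fun N _ _ x => ?_
    rw [Above]
    simp [h0, Sigma.forall]

theorem piDef_below (he : ∀ i, (e i).IsQF) {α : Ordinal.{0}} (hα : α < ω₁) {n : ℕ}
    (c : Fin n → M) : PiDef (L := L) (α + 1) (fun N _ (x : Fin n → N) => Below e M α c N x) := by
  rcases eq_or_ne α 0 with rfl | h0
  · refine ((piDef_agreeOnFirst he c).mono zero_le).congr fun N _ _ x => ?_
    rw [Below]
    simp
  have := countable_Iio_of_lt_omega_one hα
  have hs := Order.lt_add_one_iff.2 (le_refl α)
  refine (PiDef.forall_sigma (pos_of_gt hs) (ι := Σ (_ : Set.Iio α) (k : ℕ), Fin k → M)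
    (fun i N _ x => ∃ y, Above e M i.1 (Fin.append c i.2.2) N (Fin.append x y)) (fun _ => α)
    (fun _ => hs) fun i => (SigmaDef.exists_block (pos_iff_ne_zero.2 h0) (fun _ : Unit => i.2.1)
      (fun _ N _ z => Above e M i.1 (Fin.append c i.2.2) N z) (fun _ => i.1.1) (fun _ => i.1.2)
      fun _ => piDef_above he (lt_trans i.1.2 hα) _).congr fun N _ _ x => by simp).congr
      fun N _ _ x => ?_
  rw [Below]
  simp [h0, Sigma.forall]

/-- `Covered` says that every tuple satisfies a countable disjunction of `Π_{γ+1}` conditions, which is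
`∀` in front of a `Σ_{γ+2}` condition. -/
theorem piDef_covered (he : ∀ i, (e i).IsQF) {γ : Ordinal.{0}} (hγ : γ < ω₁) :
    PiDef (L := L) (n := 0) (γ + 3) (fun N _ _ => Covered e M γ N) := by
  have h12 : γ + 1 < γ + 2 := by gcongr; norm_num
  have h23 : γ + 2 < γ + 3 := by gcongr; norm_num
  refine (PiDef.forall (pos_of_gt h23) (ι := Σ (n : ℕ) (_ : ℕ), Fin n → M)
    (fun i N _ _ => ∀ z : Fin (i.1 + i.2.1) → N,
      (∃ c : Fin i.2.1 → M, Below e M γ (Fin.append i.2.2 c) N z) ∨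
        ∃ c : Fin (i.1 + i.2.1) → M, NotBelowExtension e M γ i.2.2 c ∧ Above e M γ c N z)
    fun ⟨n, k, d⟩ => PiDef.forall_closure (SigmaDef.congr (SigmaDef.exists_pi (pos_of_gt h12)
      (ι := (Fin k → M) ⊕ {c : Fin (n + k) → M // NotBelowExtension e M γ d c})
      (Sum.elim (fun c N _ z => Below e M γ (Fin.append d c) N z)
        (fun c N _ z => Above e M γ c.1 N z)) (fun _ => γ + 1) (fun _ => h12) ?_)
        fun N _ _ z => ?_) h23).congr fun N _ _ a => ?_
  · rintro (c | c)
    · exact piDef_below he hγ _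
    · exact (piDef_above he hγ _).mono (Order.lt_add_one_iff.2 le_rfl).le
  · simp
  · simp [Covered, Sigma.forall]

end Approximation

end ScottAnalysis

theorem corollary1p6 {L : FirstOrder.Language.{u, v}} [L.IsRelational]
    [Countable (Σ n, L.Relations n)]
    (e : ℕ → L.Formula ℕ) (he : ScottAnalysis.IsQFEnumeration e)
    (α : Ordinal.{0}) (hα : α < ω₁)
    (M : Type w) [L.Structure M] [Countable M] [Nonempty M] :
    ((∀ (N : Type w) [L.Structure N] [Countable N] [Nonempty N],
        ScottAnalysis.BFLe e α M N → Nonempty (M ≃[L] N)) →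
      ∃ φ : ScottAnalysis.InfFormula L 0,
        ScottAnalysis.IsPi (α + 2) φ ∧ ScottAnalysis.IsScottSentence M φ) ∧
    ((∀ (N : Type w) [L.Structure N] [Countable N] [Nonempty N],
        ScottAnalysis.BFLe e α N M → Nonempty (M ≃[L] N)) →
      ∃ φ : ScottAnalysis.InfFormula L 0,
        ScottAnalysis.IsPi (α + 1) φ ∧ ScottAnalysis.IsScottSentence M φ) := by
  have hqf : ∀ i, (e i).IsQF := fun i => by
    have : e i ∈ Set.range e := ⟨i, rfl⟩
    rwa [he] at this
  constructor
  · intro h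
    have hpos : 0 < α + 2 := by positivity
    have := ScottAnalysis.countable_Iio_of_lt_omega_one hα
    refine ScottAnalysis.isScottSentence_of_piDef (M := M)
      (P := fun N _ a => ScottAnalysis.Above e M α Fin.elim0 N a ∧
        ∀ γ : Set.Iio α, ScottAnalysis.Covered e M γ N) (.and hpos ?_ (.forall hpos _ ?_))
      ⟨(ScottAnalysis.above_self_iff _ _ _).2 (.refl _ _),
        fun _ => ScottAnalysis.covered_self _⟩ fun N _ _ _ hN => h N ?_
    · exact (ScottAnalysis.piDef_above hqf hα _).mono (by simp)
    · rintro ⟨γ, hγ⟩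
      refine (ScottAnalysis.piDef_covered hqf (lt_trans hγ hα)).mono ?_
      -- `γ + 3 = (γ + 1) + 2` and `γ + 1 ≤ α`
      rw [show (3 : Ordinal.{0}) = 1 + 2 by norm_num, ← add_assoc]
      gcongr
      exact Order.add_one_le_of_lt hγ
    · exact ScottAnalysis.backForth_of_above (fun γ hγ => hN.2 ⟨γ, hγ⟩) hN.1
  · intro h
    have hpos : 0 < α + 1 := by positivity
    have := ScottAnalysis.countable_Iio_of_lt_omega_one hα
    refine ScottAnalysis.isScottSentence_of_piDef (M := M)
      (P := fun N _ a => ScottAnalysis.Below e M α Fin.elim0 N a ∧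
        ∀ γ : {γ : Set.Iio α // γ.1 + 1 < α}, ScottAnalysis.Covered e M γ.1 N)
      (.and hpos (ScottAnalysis.piDef_below hqf hα _) (.forall hpos _ ?_))
      ⟨(ScottAnalysis.below_self_iff _ _ _).2 (.refl _ _),
        fun _ => ScottAnalysis.covered_self _⟩ fun N _ _ _ hN => h N ?_
    · rintro ⟨⟨γ, hγ⟩, hγ1⟩
      refine (ScottAnalysis.piDef_covered hqf (lt_trans hγ hα)).mono ?_
      -- `γ + 3 = ((γ + 1) + 1) + 1` and `(γ + 1) + 1 ≤ α`
      rw [show (3 : Ordinal.{0}) = 1 + 1 + 1 by norm_num, ← add_assoc, ← add_assoc]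
      gcongr
      exact Order.add_one_le_of_lt hγ1
    · exact ScottAnalysis.backForth_of_below (fun γ hγ =>
        hN.2 ⟨⟨γ, lt_trans (Order.lt_add_one_iff.2 le_rfl) hγ⟩, hγ⟩) hN.1
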